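/- Let $G$ be a finite connected multigraph with vertex set $V(G)=[n]=\{1,\dots,n\}$, $n\ge 1$ (parallel edges and loops are allowed), and let $E(G)$ be its set of edges. For a finite multigraph $H$ with at least one vertex put $g(H)=|E(H)|-|V(H)|+1$. A divisor on $G$ is a vector $D=(D(1),\dots,D(n))\in\mathbb{Z}^n$. It is a *break divisor* if $D(v)\ge 0$ for all $v\in[n]$, $\sum_{v\in[n]}D(v)=g(G)$, and $\sum_{v\in S}D(v)\ge g(G[S])$ for every nonempty $S\subseteq[n]$, where $G[S]$ is the subgraph of $G$ induced by $S$. Let $\mathrm{Break}(G)\subseteq\mathbb{Z}^n$ be the set of break divisors of $G$. Let $e_1,\dots,e_n$ be the standard basis of $\mathbb{R}^n$. Let $\mathcal Z_G\subseteq\mathbb{R}^n$ be the graphical zonotope of $G$, that is, the Minkowski sum of the segments $[e_i,e_j]$, one for each edge of $G$ (with ends $i$ and $j$). Let $\Delta_{n-1,n}\subseteq\mathbb{R}^n$ be the hypersimplex, that is, the convex hull of the orbit of the point $(1,\dots,1,0)$ (with $n-1$ ones) under permutation of the coordinates. For $P,Q\subseteq\mathbb{R}^n$ let $P-Q=\{x\in\mathbb{R}^n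 : x+q\in P\text{ for all }q\in Q\}$ be their Minkowski difference. Then $$\mathrm{Break}(G)=(\mathcal Z_G-\Delta_{n-1,n})\cap\mathbb{Z}^n .$$ Moreover, a divisor $D\in\mathbb{Z}^n$ is a break divisor of $G$ if and only if for every $q\in[n]$ the divisor $D-e_q$ is orientable, that is, there is an orientation $\mathcal O$ of the edges of $G$ such that the $v$-th coordinate of $D-e_q$ is $\mathrm{indeg}_{\mathcal O}(v)-1$ for every $v\in[n]$, where $\mathrm{indeg}_{\mathcal O}(v)$ is the number of edges directed into $v$. -/

import Mathlib

open scoped Pointwise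

namespace Graph

variable {α β : Type*}

/-- A multigraph is connected if it has a vertex and any two of its vertices are joined by a
walk. -/
def IsConnected (G : Graph α β) : Prop :=
  G.vertexSet.Nonempty ∧
    ∀ x ∈ G.vertexSet, ∀ y ∈ G.vertexSet, Relation.ReflTransGen G.Adj x y

/-- The genus `|E(G)| - |V(G)| + 1` (for graphs with finitely many vertices and edges). -/
noncomputable def genus (G : Graph α β) : ℤ :=
  (G.edgeSet.ncard : ℤ) - (G.vertexSet.ncard : ℤ) + 1

/-- An orientation of a multigraph: every edge gets a tail and a head, which are its two ends. -/
structure Orientation (G : Graph α β) where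
  /-- The tail of an edge. -/
  tail : G.edgeSet → α
  /-- The head of an edge. -/
  head : G.edgeSet → α
  /-- The tail and the head of an edge are its ends. -/
  isLink : ∀ e : G.edgeSet, G.IsLink e (tail e) (head e)

/-- The number of edges directed into `v`. -/
noncomputable def Orientation.indeg {G : Graph α β} (O : G.Orientation) (v : α) : ℕ :=
  {e : G.edgeSet | O.head e = v}.ncard

/-- A divisor on `G` (where `α` is the vertex set of `G`) is orientable if it has the form
`∑ v, (indeg_O(v) - 1) (v)` for some orientation `O` of `G`. -/
def IsOrientable (G : Graph α β) (D : α → ℤ) : Prop :=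
  ∃ O : G.Orientation, ∀ v, D v = (O.indeg v : ℤ) - 1

/-- The break divisors of `G` (where `α` is the vertex set of `G`): the effective divisors `D` of
degree `g(G)` such that `deg (D|_H) ≥ g(H)` for every induced subgraph `H` of `G`
(subgraphs have at least one vertex). -/
def breakDivisors [Fintype α] (G : Graph α β) : Set (α → ℤ) :=
  {D | (∀ v, 0 ≤ D v) ∧ ∑ v, D v = G.genus ∧
    ∀ S : Finset α, S.Nonempty → (G.induce (S : Set α)).genus ≤ ∑ v ∈ S, D v}

/-- The segment `[e_i, e_j]` attached to an edge `e` with ends `i` and `j`. The union is over the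
at most two pairs `(i, j)` and `(j, i)`, which give the same segment. -/
def edgeSegment [DecidableEq α] (G : Graph α β) (e : β) : Set (α → ℝ) :=
  {x | ∃ i j, G.IsLink e i j ∧ x ∈ segment ℝ (Pi.single i (1 : ℝ)) (Pi.single j (1 : ℝ))}

/-- The graphical zonotope of a multigraph with finitely many edges: the Minkowski sum of the
segments of its edges. -/
noncomputable def zonotope [DecidableEq α] (G : Graph α β) : Set (α → ℝ) :=
  ∑ᶠ e ∈ G.edgeSet, G.edgeSegment e

end Graph

/-- The hypersimplex `Δ_{k,n}`: the convex hull of the `S_n`-orbit of the point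
`(1, …, 1, 0, …, 0)` with `k` ones and `n - k` zeros. -/
def hypersimplex (k n : ℕ) : Set (Fin n → ℝ) :=
  convexHull ℝ (Set.range fun σ : Equiv.Perm (Fin n) =>
    fun i => if (σ i : ℕ) < k then (1 : ℝ) else 0)

/-- The Minkowski difference `P - Q = {x | x + q ∈ P for all q ∈ Q}`. This is not the pointwise
set of differences. -/
def minkowskiDifference {V : Type*} [Add V] (P Q : Set V) : Set V :=
  {x | ∀ q ∈ Q, x + q ∈ P}

/-- The lattice points `ℤⁿ` in `ℝⁿ`, as the image of this embedding. -/
def latticePoint {α : Type*} (D : α → ℤ) : α → ℝ := fun i => (D i : ℝ)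

namespace Graph

variable {α β : Type*}

/-! Everything reduces to `DominatesInduced`. The lattice points of the zonotope are the indegree
vectors of orientations, and both are the vectors satisfying this condition; the hard direction is
Hall's marriage theorem (`DominatesInduced.exists_orientation`). The zonotope is convex and
`Δ_{n-1,n}` is the hull of the points `1 - e_q`, so `D` lies in the Minkowski difference iff each `D
+ 1 - e_q` lies in the zonotope. For given `S`, the tightest of these conditions are those with `q ∈
S`, and they say exactly that `D` has degree at least `g(G[S])` on `S`. -/

/-- The condition on integer vectors that characterizes the indegree vectors of orientations: the
total is the number of edges, and the sum over `S` is at least the number of edges inside `S`. -/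
def DominatesInduced [Fintype α] (G : Graph α β) (x : α → ℤ) : Prop :=
  ∑ v, x v = G.edgeSet.ncard ∧
    ∀ S : Finset α, ((G.induce (S : Set α)).edgeSet.ncard : ℤ) ≤ ∑ v ∈ S, x v

lemma edgeSet_induce_subset (G : Graph α β) (X : Set α) : (G.induce X).edgeSet ⊆ G.edgeSet := by
  rintro e ⟨x, y, h, -, -⟩
  exact h.edge_mem

lemma edgeSegment_eq [DecidableEq α] {G : Graph α β} {e : β} {i j : α} (h : G.IsLink e i j) :
    G.edgeSegment e = segment ℝ (Pi.single i (1 : ℝ)) (Pi.single j (1 : ℝ)) := by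
  ext x
  constructor
  · rintro ⟨i', j', h', hx⟩
    rcases h.eq_and_eq_or_eq_and_eq h' with ⟨rfl, rfl⟩ | ⟨rfl, rfl⟩
    · exact hx
    · rwa [segment_symm]
  · exact fun hx => ⟨i, j, h, hx⟩

lemma zonotope_eq_sum [DecidableEq α] {G : Graph α β} (hE : G.edgeSet.Finite) :
    G.zonotope = ∑ e ∈ hE.toFinset, G.edgeSegment e :=
  finsum_mem_eq_finite_toFinset_sum _ hE

lemma convex_zonotope [DecidableEq α] {G : Graph α β} (hE : G.edgeSet.Finite) :
    Convex ℝ G.zonotope := by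
  rw [zonotope_eq_sum hE]
  refine convex_sum _ fun e he => ?_
  obtain ⟨i, j, h⟩ := exists_isLink_of_mem_edgeSet (hE.mem_toFinset.1 he)
  rw [edgeSegment_eq h]
  exact convex_segment _ _

lemma mem_zonotope [DecidableEq α] {G : Graph α β} (hE : G.edgeSet.Finite) {x : α → ℝ} :
    x ∈ G.zonotope ↔
      ∃ g : β → α → ℝ, (∀ e ∈ G.edgeSet, g e ∈ G.edgeSegment e) ∧
        ∑ e ∈ hE.toFinset, g e = x := by
  rw [zonotope_eq_sum hE, Set.mem_finsetSum]
  simp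

/-- The sum of the coordinates in `S` of a point of the segment of an edge. -/
lemma sum_edgeSegment [DecidableEq α] {G : Graph α β} {e : β} {i j : α} (h : G.IsLink e i j)
    {y : α → ℝ} (hy : y ∈ G.edgeSegment e) (S : Finset α) :
    0 ≤ ∑ v ∈ S, y v ∧ (i ∈ S → j ∈ S → ∑ v ∈ S, y v = 1) := by
  rw [edgeSegment_eq h] at hy
  obtain ⟨a, b, ha, hb, hab, rfl⟩ := hy
  have hsum : ∑ v ∈ S, (a • Pi.single i (1 : ℝ) + b • Pi.single j (1 : ℝ) : α → ℝ) v =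
      a * (if i ∈ S then 1 else 0) + b * (if j ∈ S then 1 else 0) := by
    simp [Finset.sum_add_distrib, Pi.single_apply]
  rw [hsum]
  refine ⟨by positivity, fun hi hj => by simp [hi, hj, hab]⟩

/-- An edge inside `S` contributes exactly 1 to the sum over `S`; every other edge contributes at
least 0. -/
lemma dominatesInduced_of_mem_zonotope [Fintype α] [DecidableEq α] {G : Graph α β}
    (hE : G.edgeSet.Finite) {x : α → ℤ} (hx : latticePoint x ∈ G.zonotope) :
    G.DominatesInduced x := by
  obtain ⟨g, hg, hgx⟩ := (mem_zonotope hE).1 hx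
  have hsum (S : Finset α) : ((∑ v ∈ S, x v : ℤ) : ℝ) = ∑ e ∈ hE.toFinset, ∑ v ∈ S, g e v := by
    rw [Finset.sum_comm]
    push_cast
    refine Finset.sum_congr rfl fun v _ => ?_
    rw [← Finset.sum_apply, hgx]
    rfl
  constructor
  · have h1 : ∀ e ∈ hE.toFinset, ∑ v, g e v = 1 := by
      intro e he
      rw [hE.mem_toFinset] at he
      obtain ⟨i, j, h⟩ := exists_isLink_of_mem_edgeSet he
      exact (sum_edgeSegment h (hg e he) _).2 (Finset.mem_univ _) (Finset.mem_univ _)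
    have h2 := hsum Finset.univ
    rw [Finset.sum_congr rfl h1] at h2
    rw [Set.ncard_eq_toFinset_card _ hE]
    simp only [Finset.sum_const, nsmul_eq_mul, mul_one] at h2
    exact_mod_cast h2
  · intro S
    have hF : (G.induce (S : Set α)).edgeSet.Finite := hE.subset (G.edgeSet_induce_subset _)
    have hle : ((G.induce (S : Set α)).edgeSet.ncard : ℝ) ≤ ((∑ v ∈ S, x v : ℤ) : ℝ) := by
      rw [hsum, Set.ncard_eq_toFinset_card _ hF]
      calc (hF.toFinset.card : ℝ) = ∑ e ∈ hF.toFinset, (1 : ℝ) := by simp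
        _ = ∑ e ∈ hF.toFinset, ∑ v ∈ S, g e v := by
          refine Finset.sum_congr rfl fun e he => ?_
          obtain ⟨i, j, h, hi, hj⟩ := hF.mem_toFinset.1 he
          exact ((sum_edgeSegment h (hg e h.edge_mem) _).2 hi hj).symm
        _ ≤ ∑ e ∈ hE.toFinset, ∑ v ∈ S, g e v := by
          refine Finset.sum_le_sum_of_subset_of_nonneg ?_ fun e he _ => ?_
          · simpa using G.edgeSet_induce_subset (S : Set α)
          · rw [hE.mem_toFinset] at he
            obtain ⟨i, j, h⟩ := exists_isLink_of_mem_edgeSet he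
            exact (sum_edgeSegment h (hg e he) S).1
    exact_mod_cast hle

/-- In the segment of each edge, choose the endpoint at its head. -/
lemma Orientation.indeg_mem_zonotope [DecidableEq α] {G : Graph α β}
    (hE : G.edgeSet.Finite) (O : G.Orientation) :
    (fun v => (O.indeg v : ℝ)) ∈ G.zonotope := by
  classical
  have := hE.fintype
  rw [mem_zonotope hE]
  refine ⟨fun e => if h : e ∈ G.edgeSet then Pi.single (O.head ⟨e, h⟩) 1 else 0, ?_, ?_⟩
  · intro e he
    simp only [he, dif_pos]
    rw [edgeSegment_eq (O.isLink ⟨e, he⟩)]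
    exact right_mem_segment _ _ _
  · ext v
    rw [Finset.sum_apply, Orientation.indeg,
      Finset.sum_subtype (F := inferInstance) hE.toFinset fun e => hE.mem_toFinset]
    rw [Set.ncard_eq_toFinset_card']
    simp [Pi.single_apply, eq_comm]

/-- An integer vector which dominates the induced edge counts is the vector of indegrees of an
orientation. -/
lemma DominatesInduced.exists_orientation [Fintype α] {G : Graph α β}
    (hE : G.edgeSet.Finite) {x : α → ℤ} (hx : G.DominatesInduced x) :
    ∃ O : G.Orientation, ∀ v, (O.indeg v : ℤ) = x v := by
  classical
  have := hE.fintype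
  obtain ⟨hsum, hle⟩ := hx
  have hnonneg (v : α) : 0 ≤ x v := by
    simpa using (Int.natCast_nonneg _).trans (hle {v})
  lift x to α → ℕ using hnonneg
  beta_reduce at hsum hle
  -- every edge chooses one of the `x v` slots of one of its ends `v`
  let t (e : G.edgeSet) : Finset (Σ v, Fin (x v)) := {s | G.Inc e s.1}
  -- Hall's condition: the slots open to `A` are all those at the set `S` of ends of `A`, and `A`
  -- lies in `G[S]`.
  have hall : ∀ A : Finset G.edgeSet, A.card ≤ (A.biUnion t).card := by
    intro A
    let S : Finset α := {v | ∃ e ∈ A, G.Inc e v}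
    have hS : A.biUnion t = S.sigma fun _ => Finset.univ := by
      ext ⟨v, i⟩
      simp [t, S]
    have hcard : (A.biUnion t).card = ∑ v ∈ S, x v := by simp [hS]
    have hF : (G.induce (S : Set α)).edgeSet.Finite := hE.subset (G.edgeSet_induce_subset _)
    have hA : A.card ≤ (G.induce (S : Set α)).edgeSet.ncard := by
      rw [← Finset.card_image_of_injective A Subtype.val_injective, ← Set.ncard_coe_finset]
      refine Set.ncard_le_ncard ?_ hF
      intro e he
      obtain ⟨e, heA, rfl⟩ := Finset.mem_image.1 he
      obtain ⟨i, j, h⟩ := exists_isLink_of_mem_edgeSet e.2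
      refine ⟨i, j, h, ?_, ?_⟩
      · simpa [S] using ⟨e, ⟨e.2, heA⟩, h.inc_left⟩
      · simpa [S] using ⟨e, ⟨e.2, heA⟩, h.inc_right⟩
    rw [hcard]
    exact hA.trans (by exact_mod_cast hle S)
  obtain ⟨f, hf, hft⟩ := (Finset.all_card_le_biUnion_card_iff_exists_injective t).1 hall
  have hinc (e : G.edgeSet) : G.Inc e (f e).1 := by simpa [t] using hft e
  let O : G.Orientation :=
    { tail := fun e => (hinc e).other
      head := fun e => (f e).1
      isLink := fun e => (hinc e).isLink_other.symm }
  -- As many slots as edges, so the matching fills every slot and indegrees equal `x`.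
  have hcardE : Fintype.card G.edgeSet = Fintype.card (Σ v, Fin (x v)) := by
    rw [← Nat.card_eq_fintype_card, Nat.card_coe_set_eq]
    simp only [Fintype.card_sigma, Fintype.card_fin]
    exact_mod_cast hsum.symm
  have hbij : Function.Bijective f := (Fintype.bijective_iff_injective_and_card f).2 ⟨hf, hcardE⟩
  refine ⟨O, fun v => ?_⟩
  have himage : {e : G.edgeSet | O.head e = v} = f ⁻¹' (Set.range (Sigma.mk v)) := by
    ext e
    constructor
    · rintro rfl
      exact ⟨(f e).2, rfl⟩
    · rintro ⟨i, hi⟩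
      exact (congrArg Sigma.fst hi).symm
  rw [Orientation.indeg, himage, Set.ncard_preimage_of_injective_subset_range hf
    (by simp [hbij.2.range_eq]), ← Set.image_univ,
    Set.ncard_image_of_injective _ sigma_mk_injective, Set.ncard_univ]
  simp

lemma mem_breakDivisors_iff [Fintype α] [DecidableEq α] [Nonempty α] {G : Graph α β}
    (hV : G.vertexSet = Set.univ) {D : α → ℤ} :
    D ∈ G.breakDivisors ↔ ∀ q, G.DominatesInduced (D - Pi.single q 1 + 1) := by
  have hsum (q : α) (S : Finset α) : ∑ v ∈ S, (D - Pi.single q 1 + 1 : α → ℤ) v =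
      ∑ v ∈ S, D v - (if q ∈ S then 1 else 0) + S.card := by
    simp [Finset.sum_add_distrib, Finset.sum_sub_distrib, Pi.single_apply]
  have hgenus : G.genus = G.edgeSet.ncard - (Finset.univ : Finset α).card + 1 := by
    rw [genus, hV, Set.ncard_univ, Nat.card_eq_fintype_card, Finset.card_univ]
  have hgenusS (S : Finset α) :
      (G.induce (S : Set α)).genus = (G.induce (S : Set α)).edgeSet.ncard - S.card + 1 := by
    rw [genus, vertexSet_induce, Set.ncard_coe_finset]
  constructor
  · rintro ⟨-, hdeg, hD⟩ q
    refine ⟨?_, fun S => ?_⟩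
    · rw [hsum, hdeg, hgenus, if_pos (Finset.mem_univ q)]
      ring
    · rw [hsum]
      rcases S.eq_empty_or_nonempty with rfl | hS
      · simp [edgeSet_induce]
      · have := hD S hS
        rw [hgenusS] at this
        split_ifs <;> linarith
  · intro h
    have hD (S : Finset α) (hS : S.Nonempty) :
        (G.induce (S : Set α)).genus ≤ ∑ v ∈ S, D v := by
      obtain ⟨q, hq⟩ := hS
      have := (h q).2 S
      rw [hsum, if_pos hq] at this
      rw [hgenusS]
      linarith
    refine ⟨fun v => ?_, ?_, hD⟩
    -- Effectiveness: `g(G[{v}])` is the number of loops at `v`.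
    · have := hD {v} (Finset.singleton_nonempty v)
      rw [hgenusS] at this
      simp only [Finset.card_singleton, Finset.sum_singleton] at this
      omega
    · obtain ⟨q⟩ := ‹Nonempty α›
      have := (h q).1
      rw [hsum, if_pos (Finset.mem_univ q)] at this
      rw [hgenus]
      linarith

lemma isOrientable_iff_dominatesInduced [Fintype α] [DecidableEq α] {G : Graph α β}
    (hE : G.edgeSet.Finite) {D : α → ℤ} : G.IsOrientable D ↔ G.DominatesInduced (D + 1) := by
  constructor
  · rintro ⟨O, hO⟩
    refine dominatesInduced_of_mem_zonotope hE ?_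
    convert O.indeg_mem_zonotope hE using 1
    ext v
    simp [latticePoint, hO]
  · intro h
    obtain ⟨O, hO⟩ := h.exists_orientation hE
    exact ⟨O, fun v => by simp [hO]⟩

lemma latticePoint_mem_zonotope_iff [Fintype α] [DecidableEq α] {G : Graph α β}
    (hE : G.edgeSet.Finite) {x : α → ℤ} :
    latticePoint x ∈ G.zonotope ↔ G.DominatesInduced x := by
  refine ⟨dominatesInduced_of_mem_zonotope hE, fun h => ?_⟩
  obtain ⟨O, hO⟩ := h.exists_orientation hE
  convert O.indeg_mem_zonotope hE using 1
  ext v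
  simp [latticePoint, ← hO]

end Graph

/-- The hypersimplex `Δ_{n-1,n}` is the convex hull of the points `(1, …, 1) - e_q`. -/
lemma hypersimplex_pred_eq (n : ℕ) [NeZero n] :
    hypersimplex (n - 1) n =
      convexHull ℝ (Set.range fun q : Fin n => (1 - Pi.single q 1 : Fin n → ℝ)) := by
  have hn : 0 < n := NeZero.pos n
  -- The single zero of a permuted vector sits where `σ` takes the last index as value.
  let l : Fin n := ⟨n - 1, by omega⟩
  have key (σ : Equiv.Perm (Fin n)) (q : Fin n) (hq : σ q = l) :
      (fun i => if (σ i : ℕ) < n - 1 then (1 : ℝ) else 0) = 1 - Pi.single q 1 := by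
    ext i
    by_cases hi : i = q
    · subst hi
      simp [hq, l]
    · have h1 : σ i ≠ l := fun h => hi (σ.injective (h.trans hq.symm))
      have h2 : (σ i : ℕ) < n - 1 := by
        have h3 : (σ i : ℕ) ≠ n - 1 := fun h => h1 (Fin.ext h)
        have := (σ i).isLt
        omega
      simp [h2, hi]
  rw [hypersimplex]
  congr 1
  ext x
  constructor
  · rintro ⟨σ, rfl⟩
    exact ⟨σ.symm l, (key σ _ (by simp)).symm⟩
  · rintro ⟨q, rfl⟩
    exact ⟨Equiv.swap q l, key _ _ (by simp)⟩

lemma mem_minkowskiDifference_convexHull {V : Type*} [AddCommGroup V] [Module ℝ V] {P Q : Set V}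
    (hP : Convex ℝ P) {x : V} :
    x ∈ minkowskiDifference P (convexHull ℝ Q) ↔ ∀ q ∈ Q, x + q ∈ P := by
  refine ⟨fun h q hq => h q (subset_convexHull ℝ Q hq), fun h => ?_⟩
  exact convexHull_min h (hP.translate_preimage_right x)

/-- The vertex set is `[n]`, realised as `Fin n`. Parallel edges and loops are allowed. -/
theorem proposition2p1 {β : Type*} (n : ℕ) (G : Graph (Fin n) β)
    (hV : G.vertexSet = Set.univ) (hE : G.edgeSet.Finite) (hconn : G.IsConnected) :
    latticePoint '' G.breakDivisors =
      minkowskiDifference G.zonotope (hypersimplex (n - 1) n) ∩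
        Set.range (latticePoint : (Fin n → ℤ) → (Fin n → ℝ)) ∧
    ∀ D : Fin n → ℤ,
      D ∈ G.breakDivisors ↔ ∀ q : Fin n, G.IsOrientable (D - Pi.single q (1 : ℤ)) := by

  have : NeZero n := ⟨by
    rintro rfl
    exact hconn.1.some.elim0⟩
  have hmem (D : Fin n → ℤ) : latticePoint D ∈ minkowskiDifference G.zonotope
      (hypersimplex (n - 1) n) ↔ D ∈ G.breakDivisors := by
    rw [hypersimplex_pred_eq, mem_minkowskiDifference_convexHull (G.convex_zonotope hE),
      Graph.mem_breakDivisors_iff hV, Set.forall_mem_range]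
    refine forall_congr' fun q => ?_
    rw [← Graph.latticePoint_mem_zonotope_iff hE]
    have : latticePoint D + (1 - Pi.single q 1 : Fin n → ℝ) =
        latticePoint (D - Pi.single q 1 + 1) := by
      ext v
      by_cases hv : v = q
      · subst hv
        simp [latticePoint]
      · simp [latticePoint, hv]
    rw [this]
  refine ⟨?_, fun D => ?_⟩
  · ext x
    constructor
    · rintro ⟨D, hD, rfl⟩
      exact ⟨(hmem D).2 hD, D, rfl⟩
    · rintro ⟨hx, D, rfl⟩
      exact ⟨D, (hmem D).1 hx, rfl⟩
  · rw [Graph.mem_breakDivisors_iff hV]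
    exact forall_congr' fun q => (Graph.isOrientable_iff_dominatesInduced hE).symm
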